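/- Throughout, $\log$ is the logarithm to base $2$. A $d$-regular finite simple graph $G$ on $n$ vertices is called a $\lambda$-expander ($\lambda\in\mathbb R$) if $\left|e(S,T)-\frac dn|S||T|\right|\le\lambda\sqrt{|S||T|}$ for all $S,T\subseteq V(G)$, where $e(S,T)$ is the number of edges with one endpoint in $S$ and the other in $T$, counted twice if both endpoints lie in $S\cap T$. A function $f:V(G)\to\mathbb Z$ is $M$-Lipschitz if $|f(u)-f(v)|\le M$ for every edge $\{u,v\}$ of $G$. For $k\in\mathbb Z$ let $$\mathrm{Lip}^*_k(G;M)=\Big\{f:V(G)\to\mathbb Z\ \ M\text{-Lipschitz}:\ \big|\{v\in V(G): f(v)\notin\{k,k+1,\dots,k+M\}\}\big|\le\tfrac{2\lambda}{d}\,n\Big\}.$$ Let $B(v,r)$ be the set of vertices at graph distance at most $r$ from $v$. **Theorem.** There exist universal constants $c,C>0$ such that the following holds. Let $M\ge 1$ be an integer, and let $G$ be a connected $n$-vertex $d$-regular $\lambda$-expander with $d\ge 2$, $\lambda\le d/5\le cn$ and $$M\le\min\left\{c\,\frac{d^{3/2}}{\lambda\log d},\ (\log n)^C\right\}.$$ Let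 $k\in\mathbb Z$. Then $\mathrm{Lip}^*_k(G;M)$ is finite and non-empty, and if $f$ is chosen uniformly at random from it, then for every integer $t\ge 2$ and every $v\in V(G)$, $$\mathbb P\big(f(v)>k+tM+1\big)\le 2^{-|B(v,t-1)|/(5M)}.$$ -/

import Mathlib

/-- The graph `G` on `n = |V|` vertices is a `d`-regular `lam`-expander: it is `d`-regular and
`|e(S,T) - (d/n)|S||T|| ≤ lam * √(|S||T|)` for all sets `S`, `T` of vertices. Here `e(S,T)` is the
number of pairs `(s,t)` in `S × T` with `s` adjacent to `t`, that is, the number of edges with one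
endpoint in `S` and the other in `T`, edges with both endpoints in `S ∩ T` being counted twice. -/
def IsExpander {V : Type*} [Fintype V] (G : SimpleGraph V) [DecidableRel G.Adj]
    (d : ℕ) (lam : ℝ) : Prop :=
  G.IsRegularOfDegree d ∧
    ∀ S T : Finset V,
      |((G.interedges S T).card : ℝ) - (d : ℝ) / (Fintype.card V : ℝ) * S.card * T.card| ≤
        lam * Real.sqrt ((S.card : ℝ) * T.card)

/-- Integer-valued `M`-Lipschitz functions on `G`. -/
def Lip {V : Type*} (G : SimpleGraph V) (M : ℕ) : Set (V → ℤ) :=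
  {f | ∀ u v, G.Adj u v → |f u - f v| ≤ (M : ℤ)}

/-- The `M`-Lipschitz functions on `G` with ground state `{k, …, k + M}`: those that take a value
outside of this interval on at most `(2 * lam / d) * n` vertices. -/
def LipStar {V : Type*} [Fintype V] (G : SimpleGraph V) (d : ℕ) (lam : ℝ) (M : ℕ) (k : ℤ) :
    Set (V → ℤ) :=
  {f | f ∈ Lip G M ∧
    ((Finset.univ.filter fun v => f v ∉ Finset.Icc k (k + M)).card : ℝ) ≤
      2 * lam / d * (Fintype.card V : ℝ)}

/-- The (closed) ball of radius `r` around `v` in the graph distance. -/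
def graphBall {V : Type*} (G : SimpleGraph V) (v : V) (r : ℕ) : Set V :=
  {u | G.edist u v ≤ (r : ℕ∞)}

/-!
The proof gives the bound already under `M ≤ c' * d / log d`, which follows from the hypothesis
since `√d ≤ 2 * lam` (test the expander inequality on a vertex and its neighbourhood).

Put `a = k + M` and `B = graphBall G v (t - 1)`. If `f v > k + t * M + 1`, then `f ≥ a + 2` on `B`.
The level sets `A_i = {u | f u > a + M + i}` have neighbourhoods inside `{u | f u > a + i}`; in
particular all these neighbourhoods lie outside the ground state and have at most `2n/5` elements.
Only the part of the `A_i` that is linked to `B` by steps of length at most `3` (`peak`) is used.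

*Containers.* A greedy choice (`exists_subset_hull`) yields `Q_i ⊆ A_i` with at most
`10 * |N(Q_i)| / d` elements such that `A_i` is contained in `S_i = hull G d Q_i`, the set of vertices
with nine tenths of their neighbours in `N(Q_i)`. Expansion gives `|S_i| ≤ 4/25 * |N(Q_i)|`
(`card_hull_le`).

*Flattening.* Let `u` be in `B` or in one of the sets `S_i`, `N(Q_i)`. Once the `Q_i` are known,
`f u ≤ a + M + s u`, and `f u ≥ a + β u` unless `β u = 0`; here `s u` is the number of `i` with
`u ∈ S_i`, and `β u` is the number of `i` with `u ∈ N(Q_i)`, or `2` if this is larger and `u ∈ B`.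
So `f u` has `M + 1 + s u - β u` possible values from `a` on, while moving them down to the interval
`[a, a + M]` leaves `M + 1` choices and keeps `f` in `LipStar`. Comparing the two
(`card_le_exp`) costs a factor `exp (∑ u, (s u - β u) / (M + 1))`; by the container bound each level
gains a factor `exp (-const * |N(Q_i)| / M)`, and `B` gains `exp (-|B| / (M + 1))`.

*Summation over the containers.* Each element of `Q_i` comes with a factor `z = exp (-const * d / M)`,
smaller than any needed power of `1 / d`. As `Q_{i+1} ⊆ S_i`, the sum over `Q_{i+1}` is at most
`(1 + z) ^ |S_i|`, which the gain of level `i` absorbs (`card_le_of_chain`). The set `Q_0` is linked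
to `B` by steps of length at most `7`, so that the sum over `Q_0` is at most
`exp (2 * (d + 1) ^ 7 * z * |B|)` (`sum_linkedTo_le`), a small loss against `exp (-|B| / (M + 1))`.
-/

namespace LipschitzExpander

open Finset

/-! ### Flattening a class of Lipschitz functions -/

/-- One step of the flattening at a single vertex. A value `x ≥ a` is written as `a + β + y` and
coupled with an auxiliary digit `e ∈ {0, …, M}`; the number `y * (M + 1) + e` is then split by division
with remainder by `N`, the number of admissible values of `x`. The quotient gives the new value,
counted from `a`, and the remainder is the new auxiliary digit. Values below `a` are kept. -/
def squeeze (M N β : ℕ) (a x : ℤ) (e : ℕ) : ℤ × ℕ :=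
  if x < a then (x, e)
  else (a + ((((x - a - β).toNat * (M + 1) + e) / N : ℕ) : ℤ),
    ((x - a - β).toNat * (M + 1) + e) % N)

section squeeze

variable {M s β e : ℕ} {a x : ℤ}

theorem squeeze_of_lt {N : ℕ} (h : x < a) : squeeze M N β a x e = (x, e) := by
  simp [squeeze, h]

/-- At a vertex whose value is not altered, the step is the identity, for every value `x`. -/
theorem squeeze_id (he : e ≤ M) : squeeze M (M + 1 + 0 - 0) 0 a x e = (x, e) := by
  unfold squeeze
  split_ifs with h
  · rfl
  · have h1 : ((x - a - (0 : ℕ)).toNat * (M + 1) + e) / (M + 1 + 0 - 0) = (x - a).toNat := by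
      simp only [Nat.cast_zero, sub_zero, add_zero, Nat.sub_zero]
      rw [mul_comm, Nat.mul_add_div (by omega), Nat.div_eq_of_lt (by omega), add_zero]
    have h2 : ((x - a - (0 : ℕ)).toNat * (M + 1) + e) % (M + 1 + 0 - 0) = e := by
      simp only [Nat.cast_zero, sub_zero, add_zero, Nat.sub_zero]
      rw [mul_comm, Nat.mul_add_mod, Nat.mod_eq_of_lt (by omega)]
    rw [h1, h2]
    ext
    · simp; omega
    · rfl

theorem le_squeeze_fst {N : ℕ} (h : a ≤ x) : a ≤ (squeeze M N β a x e).1 := by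
  simp [squeeze, not_lt.2 h]
  positivity

theorem squeeze_fst_le (he : e ≤ M) (h : a ≤ x) (hl : a + β ≤ x) (hu : x ≤ a + M + s) :
    (squeeze M (M + 1 + s - β) β a x e).1 ≤ a + M := by
  simp only [squeeze, not_lt.2 h, if_false]
  obtain ⟨y, hy⟩ : ∃ y : ℕ, x = a + β + y := ⟨(x - a - β).toNat, by omega⟩
  have hy' : (x - a - β).toNat = y := by omega
  rw [hy']
  have hyN : y + 1 ≤ M + 1 + s - β := by omega
  have : (y * (M + 1) + e) / (M + 1 + s - β) < M + 1 := by
    rw [Nat.div_lt_iff_lt_mul (by omega)]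
    have := Nat.mul_le_mul_right (M + 1) hyN
    nlinarith
  omega

/-- The new value does not exceed the old one: this is what makes the flattened function Lipschitz at
the boundary and keeps it in the ground state. -/
theorem squeeze_fst_le_self (he : e ≤ M) (h : a ≤ x) (hl : a + β ≤ x) (hu : x ≤ a + M + s) :
    (squeeze M (M + 1 + s - β) β a x e).1 ≤ x := by
  simp only [squeeze, not_lt.2 h, if_false]
  obtain ⟨y, hy⟩ : ∃ y : ℕ, x = a + β + y := ⟨(x - a - β).toNat, by omega⟩
  have hy' : (x - a - β).toNat = y := by omega
  rw [hy']
  obtain ⟨N, hN⟩ : ∃ N, N + β = M + 1 + s := ⟨M + 1 + s - β, by omega⟩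
  have hN' : M + 1 + s - β = N := by omega
  rw [hN']
  have hyN : y + 1 ≤ N := by omega
  have : (y * (M + 1) + e) / N < y + β + 1 := by
    rw [Nat.div_lt_iff_lt_mul (by omega)]
    have := Nat.mul_le_mul_right β hyN
    have h3 : (y + 1) * (N + β) = (y + 1) * (M + 1 + s) := by rw [hN]
    nlinarith [Nat.zero_le (y * s)]
  omega

theorem squeeze_snd_lt (h : a ≤ x) (hl : a + β ≤ x) (hu : x ≤ a + M + s) :
    (squeeze M (M + 1 + s - β) β a x e).2 < M + 1 + s - β := by
  simp only [squeeze, not_lt.2 h, if_false]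
  exact Nat.mod_lt _ (by omega)

theorem squeeze_injective {N x' e'} (he : e ≤ M) (he' : e' ≤ M)
    (hl : β = 0 ∨ a + β ≤ x) (hl' : β = 0 ∨ a + β ≤ x')
    (h : squeeze M N β a x e = squeeze M N β a x' e') : x = x' ∧ e = e' := by
  by_cases hx : x < a <;> by_cases hx' : x' < a
  · rw [squeeze_of_lt hx, squeeze_of_lt hx'] at h
    exact Prod.mk.inj h
  · have h1 := le_squeeze_fst (M := M) (N := N) (β := β) (e := e') (not_lt.1 hx')
    rw [← h, squeeze_of_lt hx] at h1
    exact absurd h1 (not_le.2 hx)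
  · have h1 := le_squeeze_fst (M := M) (N := N) (β := β) (e := e) (not_lt.1 hx)
    rw [h, squeeze_of_lt hx'] at h1
    exact absurd h1 (not_le.2 hx')
  · simp only [squeeze, hx, hx', if_false, Prod.mk.injEq, add_right_inj, Nat.cast_inj] at h
    have h2 : (x - a - β).toNat * (M + 1) + e = (x' - a - β).toNat * (M + 1) + e' := by
      rw [← Nat.div_add_mod ((x - a - β).toNat * (M + 1) + e) N, h.1, h.2, Nat.div_add_mod]
    have hq := congrArg (· / (M + 1)) h2
    have hr := congrArg (· % (M + 1)) h2
    simp only [mul_comm _ (M + 1), Nat.mul_add_mod, Nat.mul_add_div (Nat.succ_pos M)] at hq hr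
    rw [Nat.mod_eq_of_lt (by omega), Nat.mod_eq_of_lt (by omega)] at hr
    rw [Nat.div_eq_of_lt (by omega), Nat.div_eq_of_lt (by omega)] at hq
    omega

end squeeze

/-- The flattening injection. The class `𝓕` consists of functions whose values on `X` are confined
to `[a + β u, a + M + s u]`, or are below `a` where `β u = 0`; the values next to `X` are at most
`a + M`. Applying `squeeze` at every vertex injects `𝓕 × [M + 1] ^ V` into
`Ω × ∏ u, [M + 1 + s u - β u]`. -/
theorem card_mul_pow_le {V : Type*} [Fintype V] [DecidableEq V] (G : SimpleGraph V) {M : ℕ} {a : ℤ}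
    {Ω 𝓕 : Finset (V → ℤ)} {X : Finset V} {s β : V → ℕ}
    (hΩ : ∀ f ∈ 𝓕, ∀ h ∈ Lip G M, h ≤ f → (∀ u, min (f u) a ≤ h u) → h ∈ Ω)
    (hLip : ∀ f ∈ 𝓕, f ∈ Lip G M)
    (hoff : ∀ u ∉ X, s u = 0 ∧ β u = 0)
    (hup : ∀ f ∈ 𝓕, ∀ u ∈ X, f u ≤ a + M + s u)
    (hlow : ∀ f ∈ 𝓕, ∀ u, β u = 0 ∨ a + β u ≤ f u)
    (hbd : ∀ f ∈ 𝓕, ∀ u ∈ X, ∀ w ∉ X, G.Adj u w → f w ≤ a + M) :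
    𝓕.card * (M + 1) ^ Fintype.card V ≤ Ω.card * ∏ u, (M + 1 + s u - β u) := by
  let Φ : (V → ℤ) × (V → ℕ) → (V → ℤ) × (V → ℕ) := fun p =>
    (fun u => (squeeze M (M + 1 + s u - β u) (β u) a (p.1 u) (p.2 u)).1,
     fun u => (squeeze M (M + 1 + s u - β u) (β u) a (p.1 u) (p.2 u)).2)
  have key : (𝓕 ×ˢ Fintype.piFinset fun _ : V => range (M + 1)).card ≤
      (Ω ×ˢ Fintype.piFinset fun u : V => range (M + 1 + s u - β u)).card := by
    refine Finset.card_le_card_of_injOn Φ ?_ ?_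
    · rintro ⟨f, e⟩ hfe
      simp only [coe_product, Set.mem_prod, mem_coe, Fintype.mem_piFinset, mem_range,
        Nat.lt_succ_iff] at hfe ⊢
      obtain ⟨hf, he⟩ := hfe
      have hXl : ∀ u, a ≤ f u → a + β u ≤ f u := fun u hu => by
        rcases hlow f hf u with h | h
        · simpa [h] using hu
        · exact h
      have hid : ∀ u ∉ X, squeeze M (M + 1 + s u - β u) (β u) a (f u) (e u) = (f u, e u) := by
        intro u hu
        rw [(hoff u hu).1, (hoff u hu).2]
        exact squeeze_id (he u)
      have hle : ∀ u, (Φ (f, e)).1 u ≤ f u := by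
        intro u
        by_cases hu : u ∈ X
        · by_cases hfu : f u < a
          · simp [Φ, squeeze_of_lt hfu]
          · exact squeeze_fst_le_self (he u) (not_lt.1 hfu) (hXl u (not_lt.1 hfu)) (hup f hf u hu)
        · simp [Φ, hid u hu]
      have hge : ∀ u, min (f u) a ≤ (Φ (f, e)).1 u := by
        intro u
        by_cases hfu : f u < a
        · simp [Φ, squeeze_of_lt hfu]
        · exact (min_le_right _ _).trans (le_squeeze_fst (not_lt.1 hfu))
      have hub : ∀ u ∈ X, (Φ (f, e)).1 u ≤ a + M := by
        intro u hu
        by_cases hfu : f u < a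
        · have := hle u
          omega
        · exact squeeze_fst_le (he u) (not_lt.1 hfu) (hXl u (not_lt.1 hfu)) (hup f hf u hu)
      have hdir : ∀ u w, G.Adj u w → (Φ (f, e)).1 u - (Φ (f, e)).1 w ≤ M := by
        intro u w huw
        have hfl := abs_le.1 (hLip f hf u w huw)
        by_cases hw : f w < a ∨ w ∉ X
        · have hw' : (Φ (f, e)).1 w = f w := by
            rcases hw with hw | hw
            · simp [Φ, squeeze_of_lt hw]
            · simp [Φ, hid w hw]
          have := hle u
          omega
        · push Not at hw
          have h1 : a ≤ (Φ (f, e)).1 w := le_squeeze_fst hw.1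
          have h2 : (Φ (f, e)).1 u ≤ a + M := by
            by_cases hu : u ∈ X
            · exact hub u hu
            · exact (hle u).trans (hbd f hf w hw.2 u hu huw.symm)
          omega
      refine ⟨hΩ f hf _ (fun u w huw => abs_le.2 ⟨?_, hdir u w huw⟩) hle hge, fun u => ?_⟩
      · have := hdir w u huw.symm
        omega
      · by_cases hfu : f u < a
        · have hβ : β u = 0 := by
            rcases hlow f hf u with h | h
            · exact h
            · omega
          have := he u
          simp only [Φ, squeeze_of_lt hfu]
          omega
        · by_cases hu : u ∈ X
          · exact squeeze_snd_lt (not_lt.1 hfu) (hXl u (not_lt.1 hfu)) (hup f hf u hu)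
          · change (squeeze M (M + 1 + s u - β u) (β u) a (f u) (e u)).2 < _
            rw [hid u hu, (hoff u hu).1]
            have := he u
            have := (hoff u hu).2
            dsimp only
            omega
    · rintro ⟨f, e⟩ hfe ⟨f', e'⟩ hfe' heq
      simp only [coe_product, Set.mem_prod, mem_coe, Fintype.mem_piFinset, mem_range,
        Nat.lt_succ_iff] at hfe hfe'
      have : ∀ u, f u = f' u ∧ e u = e' u := fun u =>
        squeeze_injective (hfe.2 u) (hfe'.2 u) (hlow f hfe.1 u) (hlow f' hfe'.1 u)
          (Prod.ext (congrFun (congrArg Prod.fst heq) u) (congrFun (congrArg Prod.snd heq) u))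
      exact Prod.ext (funext fun u => (this u).1) (funext fun u => (this u).2)
  simpa [Finset.card_product, Fintype.card_piFinset] using key

theorem card_le_exp {V : Type*} [Fintype V] [DecidableEq V] (G : SimpleGraph V) {M : ℕ} {a : ℤ}
    {Ω 𝓕 : Finset (V → ℤ)} {X : Finset V} {s β : V → ℕ}
    (hΩ : ∀ f ∈ 𝓕, ∀ h ∈ Lip G M, h ≤ f → (∀ u, min (f u) a ≤ h u) → h ∈ Ω)
    (hLip : ∀ f ∈ 𝓕, f ∈ Lip G M)
    (hoff : ∀ u ∉ X, s u = 0 ∧ β u = 0)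
    (hup : ∀ f ∈ 𝓕, ∀ u ∈ X, f u ≤ a + M + s u)
    (hlow : ∀ f ∈ 𝓕, ∀ u, β u = 0 ∨ a + β u ≤ f u)
    (hbd : ∀ f ∈ 𝓕, ∀ u ∈ X, ∀ w ∉ X, G.Adj u w → f w ≤ a + M) :
    (𝓕.card : ℝ) ≤ Ω.card * Real.exp ((∑ u, ((s u : ℝ) - β u)) / (M + 1)) := by
  rcases 𝓕.eq_empty_or_nonempty with rfl | ⟨f, hf⟩
  · simp only [card_empty, Nat.cast_zero]
    positivity
  have h := card_mul_pow_le G hΩ hLip hoff hup hlow hbd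
  have hM : (0 : ℝ) < M + 1 := by positivity
  have hN : ∀ u, ((M + 1 + s u - β u : ℕ) : ℝ) ≤
      (M + 1) * Real.exp (((s u : ℝ) - β u) / (M + 1)) := by
    intro u
    have hβ : β u ≤ M + 1 + s u := by
      by_cases hu : u ∈ X
      · have := hup f hf u hu
        have := hlow f hf u
        omega
      · have := hoff u hu
        omega
    have h1 := Real.add_one_le_exp (((s u : ℝ) - β u) / (M + 1))
    calc ((M + 1 + s u - β u : ℕ) : ℝ) = (M + 1) * (((s u : ℝ) - β u) / (M + 1) + 1) := by
          rw [Nat.cast_sub hβ]; push_cast; field_simp; ring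
      _ ≤ _ := by gcongr
  have h2 : (𝓕.card : ℝ) * (M + 1) ^ Fintype.card V ≤
      Ω.card * ∏ u : V, ((M + 1) * Real.exp (((s u : ℝ) - β u) / (M + 1))) := by
    calc (𝓕.card : ℝ) * (M + 1) ^ Fintype.card V
        ≤ Ω.card * ∏ u, ((M + 1 + s u - β u : ℕ) : ℝ) := by exact_mod_cast h
      _ ≤ _ := by
        gcongr with u
        exact hN u
  rw [Finset.prod_mul_distrib, Finset.prod_const, ← Real.exp_sum, Finset.card_univ,
    ← Finset.sum_div] at h2
  have hp : (0 : ℝ) < (M + 1 : ℝ) ^ Fintype.card V := by positivity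
  refine le_of_mul_le_mul_right (h2.trans (le_of_eq ?_)) hp
  ring

/-! ### Enumeration of linked sets and of chains of sets -/

section Enumeration

variable {α : Type*}

/-- `Reach D B Q x`: there are `b ∈ B` and a sequence of elements of `Q` ending in `x`, the first of
them in `D b` and each later one in the `D`-neighbourhood of its predecessor. -/
inductive Reach (D : α → Finset α) (B Q : Finset α) : α → Prop
  | base {b x : α} : b ∈ B → x ∈ Q → x ∈ D b → Reach D B Q x
  | step {y x : α} : Reach D B Q y → x ∈ Q → x ∈ D y → Reach D B Q x

theorem Reach.mem {D : α → Finset α} {B Q : Finset α} {x : α} (h : Reach D B Q x) : x ∈ Q := by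
  cases h <;> assumption

theorem sum_powerset_pow_card (z : ℝ) (S : Finset α) :
    ∑ Q ∈ S.powerset, z ^ Q.card = (1 + z) ^ S.card := by
  rw [add_comm]
  simpa using Finset.sum_pow_mul_eq_add_pow z 1 S

/-- Every element of `Q` is reached from `B` through elements of `Q`. -/
def LinkedTo (D : α → Finset α) (B Q : Finset α) : Prop :=
  ∀ x ∈ Q, Reach D B Q x

/-- Peeling off the first layer: what is left of `Q` is linked to that layer. -/
theorem LinkedTo.sdiff [DecidableEq α] {D : α → Finset α} {B Q W : Finset α} (hQW : Q ⊆ W)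
    (h : LinkedTo D B Q) :
    LinkedTo D (Q ∩ (W ∩ B.biUnion D)) (Q \ (W ∩ B.biUnion D)) := by
  set E := W ∩ B.biUnion D with hE
  have aux : ∀ x, Reach D B Q x → x ∉ E → Reach D (Q ∩ E) (Q \ E) x := by
    intro x hx
    induction hx with
    | base hb hxQ hxD =>
      intro hxE
      exact absurd (mem_inter.2 ⟨hQW hxQ, mem_biUnion.2 ⟨_, hb, hxD⟩⟩) hxE
    | @step y x hy hxQ hxD ih =>
      intro hxE
      by_cases hyE : y ∈ E
      · exact .base (mem_inter.2 ⟨hy.mem, hyE⟩) (mem_sdiff.2 ⟨hxQ, hxE⟩) hxD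
      · exact .step (ih hyE) (mem_sdiff.2 ⟨hxQ, hxE⟩) hxD
  intro x hx
  rw [mem_sdiff] at hx
  exact aux x (h x hx.1) hx.2

open Classical in
/-- The generating function, in the size, of the sets linked to `B`. The sets are explored layer by
layer, and each layer is a subset of the `D`-neighbourhood of the previous one. -/
theorem sum_linkedTo_le [DecidableEq α] {D : α → Finset α} {Δ : ℕ} (hD : ∀ x, (D x).card ≤ Δ) {z : ℝ}
    (hz : 0 ≤ z) (hz2 : Real.exp (2 * Δ * z) ≤ 2) (B W : Finset α) :
    ∑ Q ∈ W.powerset with LinkedTo D B Q, z ^ Q.card ≤ Real.exp (2 * Δ * z * B.card) := by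
  induction hn : W.card using Nat.strong_induction_on generalizing B W with
  | _ n ih =>
  set E := W ∩ B.biUnion D with hE
  rcases E.eq_empty_or_nonempty with hEe | hEn
  · -- Nothing is reachable, so only `Q = ∅` contributes.
    have hsub : (W.powerset.filter (LinkedTo D B)) ⊆ {∅} := by
      intro Q hQ
      rw [mem_filter, mem_powerset] at hQ
      rw [mem_singleton, eq_empty_iff_forall_notMem]
      have : ∀ x, ¬ Reach D B Q x := by
        intro x hx
        induction hx with
        | base hb hxQ hxD =>
          have : _ ∈ E := mem_inter.2 ⟨hQ.1 hxQ, mem_biUnion.2 ⟨_, hb, hxD⟩⟩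
          simp [hEe] at this
        | step _ _ _ ih => exact ih
      exact fun x hx => this x (hQ.2 x hx)
    calc _ ≤ ∑ Q ∈ ({∅} : Finset (Finset α)), z ^ Q.card :=
          sum_le_sum_of_subset_of_nonneg hsub fun _ _ _ => by positivity
      _ = 1 := by simp
      _ ≤ _ := Real.one_le_exp (by positivity)
  · have hlt : (W \ E).card < n := by
      rw [← hn]
      refine card_lt_card ⟨sdiff_subset, fun h => ?_⟩
      obtain ⟨x, hx⟩ := hEn
      exact (mem_sdiff.1 (h (mem_inter.1 hx).1)).2 hx
    have hEc : E.card ≤ B.card * Δ :=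
      (card_le_card inter_subset_right).trans (card_biUnion_le_card_mul _ _ _ fun x _ => hD x)
    calc ∑ Q ∈ W.powerset with LinkedTo D B Q, z ^ Q.card
        ≤ ∑ p ∈ E.powerset.sigma
            (fun Q₁ => (W \ E).powerset.filter (LinkedTo D Q₁)), z ^ p.1.card * z ^ p.2.card := by
          let split : Finset α → (_ : Finset α) × Finset α := fun Q => ⟨Q ∩ E, Q \ E⟩
          have hinj : Function.Injective split := by
            intro Q Q' h
            simp only [split, Sigma.mk.injEq, heq_eq_eq] at h
            rw [← sdiff_union_inter Q E, ← sdiff_union_inter Q' E, h.1, h.2]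
          calc _ = ∑ Q ∈ W.powerset with LinkedTo D B Q,
                z ^ (split Q).1.card * z ^ (split Q).2.card := by
                refine sum_congr rfl fun Q _ => ?_
                rw [← pow_add, card_inter_add_card_sdiff]
            _ = ∑ p ∈ (W.powerset.filter (LinkedTo D B)).image split,
                z ^ p.1.card * z ^ p.2.card := 
                (sum_image (f := fun p : (_ : Finset α) × Finset α => z ^ p.1.card * z ^ p.2.card)
                  fun Q _ Q' _ h => hinj h).symm
            _ ≤ _ := by
                refine sum_le_sum_of_subset_of_nonneg ?_ fun _ _ _ => by positivity
                intro p hp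
                obtain ⟨Q, hQ, rfl⟩ := mem_image.1 hp
                simp only [split, mem_filter, mem_powerset, mem_sigma] at hQ ⊢
                exact ⟨inter_subset_right, sdiff_subset_sdiff hQ.1 subset_rfl, hQ.2.sdiff hQ.1⟩
      _ = ∑ Q₁ ∈ E.powerset, z ^ Q₁.card *
            ∑ Q₂ ∈ (W \ E).powerset with LinkedTo D Q₁ Q₂, z ^ Q₂.card := by
          rw [sum_sigma]
          simp_rw [mul_sum]
      _ ≤ ∑ Q₁ ∈ E.powerset, z ^ Q₁.card * Real.exp (2 * Δ * z * Q₁.card) := by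
          gcongr with Q₁ _
          exact ih _ hlt Q₁ (W \ E) rfl
      _ = ∑ Q₁ ∈ E.powerset, (z * Real.exp (2 * Δ * z)) ^ Q₁.card := by
          refine sum_congr rfl fun Q₁ _ => ?_
          rw [mul_pow, ← Real.exp_nat_mul, mul_comm (2 * Δ * z)]
      _ = (1 + z * Real.exp (2 * Δ * z)) ^ E.card := sum_powerset_pow_card _ _
      _ ≤ (Real.exp (2 * z)) ^ E.card := by
          gcongr
          have := Real.add_one_le_exp (2 * z)
          nlinarith
      _ = Real.exp (2 * z * E.card) := by rw [← Real.exp_nat_mul, mul_comm]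
      _ ≤ _ := by
          have : (E.card : ℝ) ≤ B.card * Δ := by exact_mod_cast hEc
          apply Real.exp_le_exp.2
          nlinarith [mul_le_mul_of_nonneg_left this hz]

end Enumeration

/-- A union bound over chains `Q_0, Q_1, …` of sets with `Q_0 ⊆ S₀` and `Q_{i+1} ⊆ S Q_i`. If the class
of elements with the chain `c` has size at most `K * ∏ i < l, w (c i)`, then the sum over all chains is
bounded from the innermost one: `∑ Q ⊆ S, z ^ |Q| = (1 + z) ^ |S|` is at most `exp (η * |S|)`, which is
the factor left over in `w Q * exp (η * |S Q|) ≤ z ^ |Q|` at the previous level. -/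
theorem card_le_of_chain {ι V : Type*} [DecidableEq V] {P : Finset V → Prop}
    {w : Finset V → ℝ} {S : Finset V → Finset V} {η z : ℝ} (hη : 0 ≤ η) (hz : 0 ≤ z)
    (hzη : 1 + z ≤ Real.exp η)
    (hw : ∀ Q, P Q → w Q * Real.exp (η * (S Q).card) ≤ z ^ Q.card)
    (l : ℕ) {K : ℝ} (hK : 0 ≤ K) (hw0 : ∀ Q, 0 ≤ w Q) (𝓕 : Finset ι) (q : ι → ℕ → Finset V)
    (S₀ : Finset V) (h0 : ∀ f ∈ 𝓕, q f 0 ⊆ S₀) (hP : ∀ f ∈ 𝓕, ∀ i, P (q f i))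
    (hchain : ∀ f ∈ 𝓕, ∀ i, q f (i + 1) ⊆ S (q f i))
    (hfib : ∀ 𝓖 ⊆ 𝓕, ∀ c : ℕ → Finset V, (∀ f ∈ 𝓖, ∀ i < l, q f i = c i) →
      (𝓖.card : ℝ) ≤ K * ∏ i ∈ range l, w (c i)) :
    (𝓕.card : ℝ) ≤ K * Real.exp (η * S₀.card) := by
  classical
  induction l generalizing K 𝓕 q S₀ with
  | zero =>
    have := hfib 𝓕 subset_rfl (fun _ => ∅) (by simp)
    rw [range_zero, prod_empty, mul_one] at this
    exact this.trans (le_mul_of_one_le_right hK (Real.one_le_exp (by positivity)))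
  | succ l ih =>
    have hfiber : ∀ Q ∈ S₀.powerset, ((𝓕.filter fun f => q f 0 = Q).card : ℝ) ≤ K * z ^ Q.card := by
      intro Q _
      rcases (𝓕.filter fun f => q f 0 = Q).eq_empty_or_nonempty with h | ⟨f₀, hf₀⟩
      · rw [h]
        simp only [card_empty, Nat.cast_zero]
        positivity
      rw [mem_filter] at hf₀
      have hPQ : P Q := hf₀.2 ▸ hP f₀ hf₀.1 0
      have := ih (K := K * w Q) (mul_nonneg hK (hw0 Q)) (𝓕.filter fun f => q f 0 = Q)
        (fun f i => q f (i + 1)) (S Q)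
        (fun f hf => by
          rw [mem_filter] at hf
          have := hchain f hf.1 0
          rwa [hf.2] at this)
        (fun f hf i => hP f (mem_filter.1 hf).1 _)
        (fun f hf i => hchain f (mem_filter.1 hf).1 _)
        (fun 𝓖 h𝓖 c hc => by
          have := hfib 𝓖 (h𝓖.trans (filter_subset _ _)) (fun i => Nat.casesOn i Q c)
            (fun f hf i hi => by
              rcases i with _ | i
              · exact (mem_filter.1 (h𝓖 hf)).2
              · exact hc f hf i (by omega))
          rw [prod_range_succ'] at this
          change _ ≤ K * ((∏ i ∈ range l, w (c i)) * w Q) at this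
          exact this.trans (le_of_eq (by ring)))
      calc _ ≤ K * w Q * Real.exp (η * (S Q).card) := this
        _ = K * (w Q * Real.exp (η * (S Q).card)) := by ring
        _ ≤ _ := by gcongr; exact hw Q hPQ
    calc (𝓕.card : ℝ) = ∑ Q ∈ S₀.powerset, ((𝓕.filter fun f => q f 0 = Q).card : ℝ) := by
          rw [card_eq_sum_card_fiberwise (f := fun f => q f 0) (t := S₀.powerset)
            (fun f hf => mem_powerset.2 (h0 f hf))]
          push_cast
          rfl
      _ ≤ ∑ Q ∈ S₀.powerset, K * z ^ Q.card := sum_le_sum hfiber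
      _ = K * (1 + z) ^ S₀.card := by rw [← mul_sum, sum_powerset_pow_card]
      _ ≤ K * (Real.exp η) ^ S₀.card := by gcongr
      _ = _ := by rw [← Real.exp_nat_mul, mul_comm η]

/-! ### Distances and local clusters -/

section Metric

variable {V : Type*} {G : SimpleGraph V}

theorem edist_le_add {x y w : V} {k l m : ℕ} (h : G.edist x y ≤ k) (h' : G.edist y w ≤ l)
    (hm : k + l ≤ m) : G.edist x w ≤ m :=
  (G.edist_triangle (v := y)).trans ((add_le_add h h').trans (by exact_mod_cast hm))

theorem edist_le_one_of_eq_or_adj {x y : V} (h : x = y ∨ G.Adj x y) : G.edist x y ≤ (1 : ℕ) := by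
  rcases h with rfl | h
  · simp
  · exact (SimpleGraph.edist_eq_one_iff_adj.2 h).le

theorem exists_edist_le_of_edist_le_succ {x w : V} {k : ℕ} (h : G.edist x w ≤ (k + 1 : ℕ)) :
    ∃ y, G.edist x y ≤ k ∧ (y = w ∨ G.Adj y w) := by
  obtain ⟨p, hp⟩ := G.exists_walk_of_edist_ne_top
    (ne_top_of_le_ne_top (ENat.natCast_ne_top (k + 1)) (SimpleGraph.edist_comm (G := G) ▸ h))
  rw [SimpleGraph.edist_comm, ← hp] at h
  cases p with
  | nil => exact ⟨x, by simp, .inl rfl⟩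
  | @cons _ y _ hwy p =>
    refine ⟨y, ?_, .inr hwy.symm⟩
    rw [SimpleGraph.Walk.length_cons] at h
    rw [SimpleGraph.edist_comm]
    exact (SimpleGraph.edist_le p).trans (by
      have : p.length + 1 ≤ k + 1 := by exact_mod_cast h
      exact_mod_cast (by omega : p.length ≤ k))

variable [Fintype V]

open Classical in
/-- The closed ball of radius `k` around `x`, as a finset. -/
noncomputable def cball (G : SimpleGraph V) (k : ℕ) (x : V) : Finset V :=
  univ.filter fun y => G.edist x y ≤ k

theorem mem_cball {k : ℕ} {x y : V} : y ∈ cball G k x ↔ G.edist x y ≤ k := by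
  simp [cball]

/-- A subset that is `2`-dense in a cluster linked by steps of length `3` is itself linked by steps of
length `2 + 3 + 2 = 7`. -/
theorem Reach.linkedTo_of_dense {A B Q : Finset V}
    (hQ : ∀ x ∈ Q, Reach (cball G 3) B A x)
    (hdense : ∀ u, Reach (cball G 3) B A u → ∃ q ∈ Q, G.edist u q ≤ (2 : ℕ)) :
    LinkedTo (cball G 7) B Q := by
  have key : ∀ u, Reach (cball G 3) B A u → ∀ q ∈ Q, G.edist u q ≤ (2 : ℕ) →
      Reach (cball G 7) B Q q := by
    intro u hu
    induction hu with
    | base hb hx hxb =>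
      intro q hq hxq
      exact .base hb hq (mem_cball.2 (edist_le_add (mem_cball.1 hxb) hxq (by norm_num)))
    | @step y x hy hx hxy ih =>
      intro q hq hxq
      obtain ⟨p, hp, hyp⟩ := hdense y hy
      refine .step (ih p hp hyp) hq (mem_cball.2 ?_)
      rw [SimpleGraph.edist_comm] at hyp
      exact edist_le_add hyp (edist_le_add (mem_cball.1 hxy) hxq le_rfl) le_rfl
  exact fun q hq => key q (hQ q hq) q hq (by simp)

open Classical in
/-- The part of `{x | a + M < f x}` that is linked to `B` by steps of length at most `3`. The length `3`
guarantees that a vertex of `{x | a + M < f x}` adjacent to a container of the peak is in the peak. -/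
noncomputable def peak (G : SimpleGraph V) (M : ℕ) (a : ℤ) (B : Finset V) (f : V → ℤ) : Finset V :=
  univ.filter fun u => Reach (cball G 3) B (univ.filter fun x => a + M < f x) u

theorem mem_peak {M : ℕ} {a : ℤ} {B : Finset V} {f : V → ℤ} {u : V} :
    u ∈ peak G M a B f ↔ Reach (cball G 3) B (univ.filter fun x => a + M < f x) u := by
  classical
  simp [peak]

end Metric

/-! ### Containers for the level sets -/

section Containers

variable {V : Type*} [Fintype V] (G : SimpleGraph V) [DecidableEq V] [DecidableRel G.Adj]

variable {G} in
theorem card_cball_le {d : ℕ} (hG : G.IsRegularOfDegree d) (k : ℕ) (x : V) :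
    (cball G k x).card ≤ (d + 1) ^ k := by
  induction k with
  | zero =>
    have : cball G 0 x = {x} := by
      ext y
      simp [mem_cball, eq_comm (a := y)]
    simp [this]
  | succ k ih =>
    have hsub : cball G (k + 1) x ⊆ (cball G k x).biUnion fun y => insert y (G.neighborFinset y) := by
      intro w hw
      obtain ⟨y, hy, hyw⟩ := exists_edist_le_of_edist_le_succ (mem_cball.1 hw)
      refine mem_biUnion.2 ⟨y, mem_cball.2 hy, ?_⟩
      rw [mem_insert, SimpleGraph.mem_neighborFinset]
      exact hyw.imp Eq.symm id
    calc _ ≤ _ := card_le_card hsub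
      _ ≤ (cball G k x).card * (d + 1) := card_biUnion_le_card_mul _ _ _ fun y _ =>
          (card_insert_le _ _).trans (by rw [SimpleGraph.card_neighborFinset_eq_degree, hG y])
      _ ≤ (d + 1) ^ (k + 1) := by rw [pow_succ]; gcongr

/-- The set of vertices with a neighbour in `Q`. -/
def nbrs (Q : Finset V) : Finset V := Q.biUnion fun q => G.neighborFinset q

variable {G} in
theorem mem_nbrs {Q : Finset V} {u : V} : u ∈ nbrs G Q ↔ ∃ q ∈ Q, G.Adj q u := by
  simp [nbrs]

/-- The vertices with at least nine tenths of their neighbours in `nbrs G Q` (in a `d`-regular graph). -/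
def hull (d : ℕ) (Q : Finset V) : Finset V :=
  univ.filter fun u => 10 * (G.neighborFinset u \ nbrs G Q).card ≤ d

variable {G}

/-- The greedy container: for a maximal `Q ⊆ T` such that `nbrs G Q` has at least `d / 10` elements
for each element of `Q`, no vertex of `T` has more than `d / 10` neighbours outside `nbrs G Q`. -/
theorem exists_subset_hull {d : ℕ} (T : Finset V) :
    ∃ Q ⊆ T, T ⊆ hull G d Q ∧ d * Q.card ≤ 10 * (nbrs G Q).card := by
  obtain ⟨Q, hQ, hmax⟩ := exists_max_image
    (T.powerset.filter fun Q => d * Q.card ≤ 10 * (nbrs G Q).card) card ⟨∅, by simp⟩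
  simp only [mem_filter, mem_powerset] at hQ hmax
  refine ⟨Q, hQ.1, fun u hu => ?_, hQ.2⟩
  by_contra hun
  simp only [hull, mem_filter, mem_univ, true_and, not_le] at hun
  have huQ : u ∉ Q := by
    intro huQ
    have : G.neighborFinset u \ nbrs G Q = ∅ :=
      sdiff_eq_empty_iff_subset.2 (subset_biUnion_of_mem (fun q => G.neighborFinset q) huQ)
    simp [this] at hun
  have hn : (nbrs G (insert u Q)).card =
      (G.neighborFinset u \ nbrs G Q).card + (nbrs G Q).card := by
    rw [nbrs, biUnion_insert, ← card_sdiff_add_card]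
    rfl
  have := hmax (insert u Q) ⟨insert_subset hu hQ.1, by
    rw [card_insert_of_notMem huQ, hn]
    nlinarith [hQ.2]⟩
  rw [card_insert_of_notMem huQ] at this
  omega

theorem card_interedges_eq (S T : Finset V) :
    (G.interedges S T).card = ∑ u ∈ S, (G.neighborFinset u ∩ T).card := by
  rw [SimpleGraph.interedges, Rel.interedges, card_filter, sum_product]
  refine sum_congr rfl fun u _ => ?_
  rw [← card_filter]
  congr 1
  ext w
  simp [and_comm]

/-- Expansion between `hull G d Q` and `nbrs G Q`, with the edge density `9/10` from the first to the
second, of which a random-like distribution would explain only `2/5`. -/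
theorem card_hull_le {d : ℕ} {lam : ℝ} (hG : IsExpander G d lam) (hd : 0 < d)
    (hlam : lam ≤ d / 5) {Q : Finset V}
    (hQ : ((nbrs G Q).card : ℝ) ≤ 2 / 5 * Fintype.card V) :
    ((hull G d Q).card : ℝ) ≤ 4 / 25 * (nbrs G Q).card := by
  rcases (hull G d Q).eq_empty_or_nonempty with h | ⟨v, -⟩
  · rw [h]; simp
  have hn : (0 : ℝ) < Fintype.card V := by exact_mod_cast Fintype.card_pos_iff.2 ⟨v⟩
  have hd' : (0 : ℝ) < d := by exact_mod_cast hd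
  set S := hull G d Q with hS
  set F := nbrs G Q with hF
  have he : 9 * (d * S.card) ≤ 10 * (G.interedges S F).card := by
    rw [card_interedges_eq, mul_sum, ← mul_assoc, mul_comm (9 * d), ← smul_eq_mul (S.card)]
    refine card_nsmul_le_sum _ _ _ fun u hu => ?_
    have h1 : 10 * (G.neighborFinset u \ F).card ≤ d := (mem_filter.1 hu).2
    have h2 := card_inter_add_card_sdiff (G.neighborFinset u) F
    rw [SimpleGraph.card_neighborFinset_eq_degree, hG.1 u] at h2
    omega
  have he' : 9 * ((d : ℝ) * S.card) ≤ 10 * (G.interedges S F).card := by exact_mod_cast he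
  have hexp := (abs_le.1 (hG.2 S F)).2
  rw [Real.sqrt_mul (by positivity)] at hexp
  generalize hx : (S.card : ℝ) = x at *
  generalize hy : (F.card : ℝ) = y at *
  generalize (Fintype.card V : ℝ) = n at *
  have hσ2 : Real.sqrt x ^ 2 = x := Real.sq_sqrt (by rw [← hx]; positivity)
  have hφ2 : Real.sqrt y ^ 2 = y := Real.sq_sqrt (by rw [← hy]; positivity)
  have hσ0 := Real.sqrt_nonneg x
  have hφ0 := Real.sqrt_nonneg y
  generalize Real.sqrt x = σ at *
  generalize Real.sqrt y = φ at *
  clear hx hy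
  subst hσ2 hφ2
  have h1 : (d : ℝ) / n * σ ^ 2 * φ ^ 2 ≤ 2 / 5 * d * σ ^ 2 := by
    calc (d : ℝ) / n * σ ^ 2 * φ ^ 2 ≤ (d : ℝ) / n * σ ^ 2 * (2 / 5 * n) := by gcongr
      _ = _ := by field_simp
  have h2 : lam * (σ * φ) ≤ d / 5 * (σ * φ) := by gcongr
  have h3 : (d : ℝ) * (5 * σ ^ 2) ≤ d * (2 * (σ * φ)) := by linarith
  have h4 := le_of_mul_le_mul_left h3 hd'
  have h5 : 5 * σ ≤ 2 * φ := by
    rcases hσ0.eq_or_lt with h | h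
    · rw [← h]; simpa using hφ0
    · nlinarith
  nlinarith

/-- The sets `q i` are containers for the levels `{u | a + M + i < f u}` of the peak of `f`: they are
small sets within these levels whose hulls cover the levels. -/
structure IsLayering (G : SimpleGraph V) [DecidableRel G.Adj] (d M : ℕ) (a : ℤ) (B : Finset V)
    (f : V → ℤ) (q : ℕ → Finset V) : Prop where
  subset_peak : ∀ i, ∀ x ∈ q i, x ∈ peak G M a B f
  lt : ∀ i : ℕ, ∀ x ∈ q i, a + M + i < f x
  mem_hull : ∀ i : ℕ, ∀ u ∈ peak G M a B f, a + M + i < f u → u ∈ hull G d (q i)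
  card_le : ∀ i, d * (q i).card ≤ 10 * (nbrs G (q i)).card

theorem exists_isLayering (G : SimpleGraph V) [DecidableRel G.Adj] (d M : ℕ) (a : ℤ)
    (B : Finset V) (f : V → ℤ) : ∃ q, IsLayering G d M a B f q := by
  choose q hq hT hc using fun i : ℕ =>
    exists_subset_hull (G := G) (d := d) ((peak G M a B f).filter fun u => a + M + i < f u)
  exact ⟨q, fun i x hx => (mem_filter.1 (hq i hx)).1, fun i x hx => (mem_filter.1 (hq i hx)).2,
    fun i u hu hfu => hT i (mem_filter.2 ⟨hu, hfu⟩), hc⟩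

theorem exists_adj_nbrs_of_mem_hull {d : ℕ} (hG : G.IsRegularOfDegree d) (hd : 0 < d)
    {Q : Finset V} {u : V} (hu : u ∈ hull G d Q) : ∃ q ∈ Q, ∃ y, G.Adj q y ∧ G.Adj y u := by
  have h1 : 10 * (G.neighborFinset u \ nbrs G Q).card ≤ d := (mem_filter.1 hu).2
  have h2 := card_inter_add_card_sdiff (G.neighborFinset u) (nbrs G Q)
  rw [SimpleGraph.card_neighborFinset_eq_degree, hG u] at h2
  obtain ⟨y, hy⟩ : (G.neighborFinset u ∩ nbrs G Q).Nonempty := card_pos.1 (by omega)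
  rw [mem_inter, SimpleGraph.mem_neighborFinset, mem_nbrs] at hy
  obtain ⟨q, hq, hqy⟩ := hy.2
  exact ⟨q, hq, y, hqy, hy.1.symm⟩

namespace IsLayering

variable {d M : ℕ} {a : ℤ} {B : Finset V} {f : V → ℤ} {q : ℕ → Finset V}

theorem subset_hull (h : IsLayering G d M a B f q) (i : ℕ) : q (i + 1) ⊆ hull G d (q i) :=
  fun x hx => h.mem_hull i x (h.subset_peak _ x hx) (by
    have := h.lt _ x hx
    push_cast at this
    omega)

theorem linkedTo (h : IsLayering G d M a B f q) (hG : G.IsRegularOfDegree d) (hd : 0 < d) :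
    LinkedTo (cball G 7) B (q 0) := by
  refine Reach.linkedTo_of_dense (fun x hx => mem_peak.1 (h.subset_peak 0 x hx)) fun u hu => ?_
  have hfu : a + M < f u := by simpa using hu.mem
  obtain ⟨x, hx, y, hxy, hyu⟩ := exists_adj_nbrs_of_mem_hull hG hd
    (h.mem_hull 0 u (mem_peak.2 hu) (by simpa using hfu))
  exact ⟨x, hx, edist_le_add (edist_le_one_of_eq_or_adj (.inr hyu.symm))
    (edist_le_one_of_eq_or_adj (.inr hxy.symm)) le_rfl⟩

theorem lt_of_mem_nbrs (h : IsLayering G d M a B f q) (hf : f ∈ Lip G M) {i : ℕ} {u : V}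
    (hu : u ∈ nbrs G (q i)) : a + i < f u := by
  obtain ⟨x, hx, hxu⟩ := mem_nbrs.1 hu
  have h1 := abs_le.1 (hf x u hxu)
  have h2 := h.lt i x hx
  omega

theorem mem_peak_of_near (h : IsLayering G d M a B f q) (hG : G.IsRegularOfDegree d) (hd : 0 < d)
    {u w : V} (hu : u ∈ B ∨ ∃ i, u ∈ hull G d (q i) ∪ nbrs G (q i)) (huw : u = w ∨ G.Adj u w)
    (hw : a + M < f w) : w ∈ peak G M a B f := by
  rw [mem_peak]
  have hwA : w ∈ univ.filter fun x => a + M < f x := by simpa using hw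
  have h1 := edist_le_one_of_eq_or_adj huw
  rcases hu with hu | ⟨i, hu⟩
  · exact .base hu hwA (mem_cball.2 (h1.trans (by norm_num)))
  rcases mem_union.1 hu with hu | hu
  · obtain ⟨x, hx, y, hxy, hyu⟩ := exists_adj_nbrs_of_mem_hull hG hd hu
    refine .step (mem_peak.1 (h.subset_peak i x hx)) hwA (mem_cball.2 ?_)
    exact edist_le_add (edist_le_add (edist_le_one_of_eq_or_adj (.inr hxy))
      (edist_le_one_of_eq_or_adj (.inr hyu)) le_rfl) h1 le_rfl
  · obtain ⟨x, hx, hxu⟩ := mem_nbrs.1 hu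
    refine .step (mem_peak.1 (h.subset_peak i x hx)) hwA (mem_cball.2 ?_)
    exact edist_le_add (edist_le_one_of_eq_or_adj (.inr hxu)) h1 (by norm_num)

end IsLayering

/-- The factor contributed by a level with container `Q` to the number of functions. Half of the gain
from `nbrs G Q` is given up, so that the gain from `B` is available also where `B` meets `nbrs G Q`. -/
noncomputable def weight (G : SimpleGraph V) [DecidableRel G.Adj] (d M : ℕ) (Q : Finset V) : ℝ :=
  Real.exp (((hull G d Q).card - (nbrs G Q).card / 2) / (M + 1))

/-- The number of functions with a given sequence of containers, if they are at least `a + 2` on `B`. -/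
theorem card_le_of_layering {d M : ℕ} (hG : G.IsRegularOfDegree d) (hd : 0 < d) {a : ℤ}
    {B : Finset V} {Ω 𝓖 : Finset (V → ℤ)} {c : ℕ → Finset V} {L : ℕ}
    {q : (V → ℤ) → ℕ → Finset V}
    (hΩ : ∀ f ∈ 𝓖, ∀ h ∈ Lip G M, h ≤ f → (∀ u, min (f u) a ≤ h u) → h ∈ Ω)
    (hLip : ∀ f ∈ 𝓖, f ∈ Lip G M)
    (hL : ∀ f ∈ 𝓖, ∀ u, f u ≤ a + M + L)
    (hB : ∀ f ∈ 𝓖, ∀ u ∈ B, a + 2 ≤ f u)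
    (hq : ∀ f ∈ 𝓖, IsLayering G d M a B f (q f))
    (hc : ∀ f ∈ 𝓖, ∀ i < L, q f i = c i) :
    (𝓖.card : ℝ) ≤
      Ω.card * Real.exp (-(B.card : ℝ) / (M + 1)) * ∏ i ∈ range L, weight G d M (c i) := by
  let X : Finset V := B ∪ (range L).biUnion fun i => hull G d (c i) ∪ nbrs G (c i)
  let s : V → ℕ := fun u => ((range L).filter fun i => u ∈ hull G d (c i)).card
  let φ : V → ℕ := fun u => ((range L).filter fun i => u ∈ nbrs G (c i)).card
  -- The value `2` on `B` costs nothing where level sets already force more.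
  let β : V → ℕ := fun u => max (φ u) (if u ∈ B then 2 else 0)
  have hnear : ∀ f ∈ 𝓖, ∀ u ∈ X, ∀ w, u = w ∨ G.Adj u w → a + M < f w →
      w ∈ peak G M a B f := by
    intro f hf u hu w huw hw
    refine (hq f hf).mem_peak_of_near hG hd ?_ huw hw
    rcases mem_union.1 hu with hu | hu
    · exact .inl hu
    · obtain ⟨i, hi, hu⟩ := mem_biUnion.1 hu
      exact .inr ⟨i, by rwa [hc f hf i (mem_range.1 hi)]⟩
  have hpeak : ∀ f ∈ 𝓖, ∀ w ∈ peak G M a B f, ∀ i < L, a + M + i < f w → w ∈ hull G d (c i) := by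
    intro f hf w hw i hi hfw
    rw [← hc f hf i hi]
    exact (hq f hf).mem_hull i w hw hfw
  have hφ : ∀ f ∈ 𝓖, ∀ u, φ u = 0 ∨ a + φ u ≤ f u := by
    intro f hf u
    by_contra! hcon
    -- `u ∈ nbrs G (c i)` forces `a + i < f u`, so there are at most `f u - a` such `i`.
    have hsub : ((range L).filter fun i => u ∈ nbrs G (c i)) ⊆ range (f u - a).toNat := by
      intro i hi
      rw [mem_filter, mem_range] at hi
      have := (hq f hf).lt_of_mem_nbrs (hLip f hf) (i := i) (u := u)
        (by rw [hc f hf i hi.1]; exact hi.2)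
      rw [mem_range]
      omega
    have h1 : φ u ≤ (f u - a).toNat := by simpa using card_le_card hsub
    omega
  have key := card_le_exp G (Ω := Ω) (𝓕 := 𝓖) (X := X) (s := s) (β := β) (M := M) (a := a)
    hΩ hLip ?_ ?_ ?_ ?_
  · refine key.trans ?_
    rw [mul_assoc]
    gcongr
    unfold weight
    rw [← Real.exp_sum, ← Real.exp_add, ← sum_div, ← add_div]
    gcongr
    have hs : ∑ u, (s u : ℝ) = ∑ i ∈ range L, ((hull G d (c i)).card : ℝ) := by
      simp only [s, card_filter]
      push_cast
      rw [sum_comm]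
      simp
    have hφs : ∑ u, (φ u : ℝ) = ∑ i ∈ range L, ((nbrs G (c i)).card : ℝ) := by
      simp only [φ, card_filter]
      push_cast
      rw [sum_comm]
      simp
    have hBs : ∑ u, (if u ∈ B then (1 : ℝ) else 0) = B.card := by simp
    -- The maximum of `φ u` and `2` is at least their mean.
    have hβ : ∀ u, (φ u : ℝ) / 2 + (if u ∈ B then (1 : ℝ) else 0) ≤ β u := by
      intro u
      have h1 : (φ u : ℝ) ≤ β u := by exact_mod_cast le_max_left _ _
      have h2 : ((if u ∈ B then 2 else 0 : ℕ) : ℝ) ≤ β u := by exact_mod_cast le_max_right _ _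
      split_ifs at h2 ⊢ <;> push_cast at h2 <;> linarith
    have := sum_le_sum fun u (_ : u ∈ univ) => hβ u
    rw [sum_add_distrib, ← sum_div, hφs, hBs] at this
    rw [sum_sub_distrib, hs, sum_sub_distrib, ← sum_div]
    linarith
  · intro u hu
    rw [mem_union, mem_biUnion] at hu
    push Not at hu
    have h1 : s u = 0 := card_eq_zero.2 (filter_eq_empty_iff.2 fun i hi h =>
      hu.2 i hi (mem_union_left _ h))
    have h2 : φ u = 0 := card_eq_zero.2 (filter_eq_empty_iff.2 fun i hi h =>
      hu.2 i hi (mem_union_right _ h))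
    exact ⟨h1, by simp [β, h2, hu.1]⟩
  · intro f hf u hu
    by_contra! hcon
    have hpu : u ∈ peak G M a B f := hnear f hf u hu u (.inl rfl) (by omega)
    -- A value above `a + M` puts `u` into the peak, hence into the hull of every level below it.
    have hsub : range (f u - a - M).toNat ⊆ (range L).filter fun i => u ∈ hull G d (c i) := by
      intro i hi
      rw [mem_range] at hi
      have := hL f hf u
      rw [mem_filter, mem_range]
      exact ⟨by omega, hpeak f hf u hpu i (by omega) (by omega)⟩
    have h1 : (f u - a - M).toNat ≤ s u := by simpa using card_le_card hsub
    omega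
  · intro f hf u
    have h1 := hφ f hf u
    by_cases hu : u ∈ B
    · have h2 := hB f hf u hu
      simp only [β, hu, if_true]
      omega
    · simpa [β, hu] using h1
  · intro f hf u hu w hw huw
    by_contra! hcon
    refine hw (mem_union_right _ (mem_biUnion.2 ⟨0, ?_, mem_union_left _ ?_⟩))
    · have := hL f hf w
      rw [mem_range]
      omega
    · refine hpeak f hf w (hnear f hf u hu w (.inr huw) hcon) 0 ?_ (by simpa using hcon)
      have := hL f hf w
      omega

end Containers

/-! ### Functions that are elevated on a given set -/

section Main

variable {V : Type*} [Fintype V] {G : SimpleGraph V}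

/-- The gain of a level absorbs the loss from the choice of the next container within `hull G d Q`
and leaves a factor `exp (-d / (64 * (M + 1)))` for each element of `Q`. -/
theorem weight_mul_exp_le [DecidableEq V] [DecidableRel G.Adj] {d M : ℕ} {lam : ℝ}
    (hG : IsExpander G d lam) (hd : 0 < d) (hlam : lam ≤ d / 5) {Q : Finset V}
    (hQ : ((nbrs G Q).card : ℝ) ≤ 2 / 5 * Fintype.card V)
    (hc : d * Q.card ≤ 10 * (nbrs G Q).card) :
    weight G d M Q * Real.exp (1 / (M + 1) * (hull G d Q).card) ≤
      Real.exp (-(d : ℝ) / (64 * (M + 1))) ^ Q.card := by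
  have h1 := card_hull_le hG hd hlam hQ
  have h2 : (d : ℝ) * Q.card ≤ 10 * (nbrs G Q).card := by exact_mod_cast hc
  rw [weight, ← Real.exp_add, ← Real.exp_nat_mul]
  apply Real.exp_le_exp.2
  have hM : (0 : ℝ) < M + 1 := by positivity
  have h3 : (0 : ℝ) ≤ d * Q.card := by positivity
  have e1 : ((hull G d Q).card - (nbrs G Q).card / 2 : ℝ) / (M + 1) +
      1 / (M + 1) * (hull G d Q).card =
      (2 * (hull G d Q).card - (nbrs G Q).card / 2) / (M + 1) := by ring
  have e2 : (Q.card : ℝ) * (-(d : ℝ) / (64 * (M + 1))) = (-(d * Q.card / 64)) / (M + 1) := by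
    field_simp
  rw [e1, e2]
  gcongr
  linarith

/-- The number of functions that are at least `a + 2` on `B` and at most `a` on three fifths of the
vertices, compared with a family `Ω` that is closed under lowering values towards `a`. -/
theorem card_elevated_le [DecidableEq V] [DecidableRel G.Adj] {d M : ℕ} {lam z : ℝ}
    (hG : IsExpander G d lam) (hd : 0 < d) (hlam : lam ≤ d / 5) {a : ℤ} {B : Finset V}
    {Ω 𝓕 : Finset (V → ℤ)}
    (hΩ : ∀ f ∈ 𝓕, ∀ h ∈ Lip G M, h ≤ f → (∀ u, min (f u) a ≤ h u) → h ∈ Ω)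
    (hLip : ∀ f ∈ 𝓕, f ∈ Lip G M)
    (hB : ∀ f ∈ 𝓕, ∀ u ∈ B, a + 2 ≤ f u)
    (hlow : ∀ f ∈ 𝓕, ((univ.filter fun u => a < f u).card : ℝ) ≤ 2 / 5 * Fintype.card V)
    (hz : z = Real.exp (-(d : ℝ) / (64 * (M + 1)))) (hz1 : z ≤ 1 / (M + 1))
    (hz2 : Real.exp (2 * ((d + 1) ^ 7 : ℕ) * z) ≤ 2) :
    (𝓕.card : ℝ) ≤ Ω.card *
      Real.exp (-(B.card : ℝ) / (M + 1) + 2 * ((d + 1) ^ 7 : ℕ) * z * B.card) := by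
  classical
  have hz0 : 0 ≤ z := hz ▸ (Real.exp_pos _).le
  choose q hq using fun f : V → ℤ => exists_isLayering G d M a B f
  obtain ⟨L, hL⟩ : ∃ L : ℕ, ∀ f ∈ 𝓕, ∀ u, f u ≤ a + M + L := by
    refine ⟨∑ f ∈ 𝓕, ∑ u, (f u - a - M).toNat, fun f hf u => ?_⟩
    have h1 := single_le_sum (f := fun f : V → ℤ => ∑ u, (f u - a - M).toNat)
      (fun _ _ => Nat.zero_le _) hf
    have h2 := single_le_sum (f := fun u => (f u - a - M).toNat)
      (fun _ _ => Nat.zero_le _) (mem_univ u)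
    omega
  set P : Finset V → Prop := fun Q =>
    ((nbrs G Q).card : ℝ) ≤ 2 / 5 * Fintype.card V ∧ d * Q.card ≤ 10 * (nbrs G Q).card with hPdef
  have hP : ∀ f ∈ 𝓕, ∀ i, P (q f i) := by
    refine fun f hf i => ⟨le_trans ?_ (hlow f hf), (hq f).card_le i⟩
    exact_mod_cast card_le_card fun u hu => by
      have := (hq f).lt_of_mem_nbrs (hLip f hf) hu
      rw [mem_filter]
      exact ⟨mem_univ _, by omega⟩
  have hw : ∀ Q, P Q → weight G d M Q * Real.exp (1 / (M + 1) * (hull G d Q).card) ≤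
      z ^ Q.card := fun Q hQ => hz ▸ weight_mul_exp_le hG hd hlam hQ.1 hQ.2
  have hw0 : ∀ Q, 0 ≤ weight G d M Q := fun Q => (Real.exp_pos _).le
  set K : ℝ := Ω.card * Real.exp (-(B.card : ℝ) / (M + 1)) with hK
  have hK0 : 0 ≤ K := by positivity
  have hfiber : ∀ Q, ((𝓕.filter fun f => q f 0 = Q).card : ℝ) ≤ K * z ^ Q.card := by
    intro Q
    rcases (𝓕.filter fun f => q f 0 = Q).eq_empty_or_nonempty with h | ⟨f₀, hf₀⟩
    · rw [h]
      simp only [card_empty, Nat.cast_zero]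
      positivity
    rw [mem_filter] at hf₀
    have hPQ : P Q := hf₀.2 ▸ hP f₀ hf₀.1 0
    have := card_le_of_chain (P := P) (w := weight G d M) (S := hull G d) (η := 1 / (M + 1))
      (by positivity) hz0
      (by linarith [Real.add_one_le_exp (1 / (M + 1) : ℝ)]) hw L
      (mul_nonneg hK0 (hw0 Q)) hw0 (𝓕.filter fun f => q f 0 = Q) (fun f i => q f (i + 1))
      (hull G d Q)
      (fun f hf => (mem_filter.1 hf).2 ▸ (hq f).subset_hull 0)
      (fun f hf i => hP f (mem_filter.1 hf).1 _)
      (fun f hf i => (hq f).subset_hull _)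
      (fun 𝓖 h𝓖 c hc => by
        have h𝓖' : ∀ f ∈ 𝓖, f ∈ 𝓕 := fun f hf => (mem_filter.1 (h𝓖 hf)).1
        have := card_le_of_layering (G := G) (M := M) (a := a) (B := B) (Ω := Ω) (𝓖 := 𝓖)
          (c := fun i => Nat.casesOn i Q c) (L := L + 1) (q := q) hG.1 hd
          (fun f hf => hΩ f (h𝓖' f hf)) (fun f hf => hLip f (h𝓖' f hf))
          (fun f hf u => (hL f (h𝓖' f hf) u).trans (by push_cast; omega))
          (fun f hf => hB f (h𝓖' f hf)) (fun f _ => hq f)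
          (fun f hf i hi => by
            rcases i with _ | i
            · exact (mem_filter.1 (h𝓖 hf)).2
            · exact hc f hf i (by omega))
        rw [prod_range_succ'] at this
        change _ ≤ K * ((∏ i ∈ range L, weight G d M (c i)) * weight G d M Q) at this
        exact this.trans (le_of_eq (by ring)))
    calc _ ≤ _ := this
      _ = K * (weight G d M Q * Real.exp (1 / (M + 1) * (hull G d Q).card)) := by ring
      _ ≤ _ := by gcongr; exact hw Q hPQ
  calc (𝓕.card : ℝ)
      = ∑ Q ∈ (univ : Finset V).powerset with LinkedTo (cball G 7) B Q,
          ((𝓕.filter fun f => q f 0 = Q).card : ℝ) := by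
        rw [card_eq_sum_card_fiberwise (f := fun f => q f 0)
          (t := (univ : Finset V).powerset.filter (LinkedTo (cball G 7) B))
          (fun f _ => by simpa using (hq f).linkedTo hG.1 hd)]
        push_cast
        rfl
    _ ≤ ∑ Q ∈ (univ : Finset V).powerset with LinkedTo (cball G 7) B Q, K * z ^ Q.card :=
        sum_le_sum fun Q _ => hfiber Q
    _ = K * ∑ Q ∈ (univ : Finset V).powerset with LinkedTo (cball G 7) B Q, z ^ Q.card := by
        rw [mul_sum]
    _ ≤ K * Real.exp (2 * ((d + 1) ^ 7 : ℕ) * z * B.card) := by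
        gcongr
        exact sum_linkedTo_le (card_cball_le hG.1 7) hz0 hz2 B univ
    _ = _ := by rw [hK, mul_assoc, ← Real.exp_add]

theorem abs_sub_le_length_mul {V : Type*} {G : SimpleGraph V} {M : ℕ} {f : V → ℤ}
    (hf : f ∈ Lip G M) {u w : V} (p : G.Walk u w) : |f u - f w| ≤ p.length * M := by
  induction p with
  | nil => simp
  | @cons u v w h p ih =>
    have := hf u v h
    rw [SimpleGraph.Walk.length_cons]
    push_cast
    calc |f u - f w| ≤ |f u - f v| + |f v - f w| := abs_sub_le _ _ _
      _ ≤ M + p.length * M := add_le_add this ih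
      _ = _ := by ring

/-! ### The parameters -/

/-- The expander inequality for a vertex and its neighbourhood. -/
theorem sqrt_le_two_mul_lam [DecidableRel G.Adj] [Nonempty V] {d : ℕ} {lam : ℝ}
    (hG : IsExpander G d lam) (hd : (d : ℝ) ≤ Fintype.card V / 2) : Real.sqrt d ≤ 2 * lam := by
  classical
  obtain ⟨v⟩ := ‹Nonempty V›
  have hn : (0 : ℝ) < Fintype.card V := by exact_mod_cast Fintype.card_pos_iff.2 ⟨v⟩
  have hcard : (G.neighborFinset v).card = d := by
    rw [SimpleGraph.card_neighborFinset_eq_degree, hG.1 v]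
  have h := (abs_le.1 (hG.2 {v} (G.neighborFinset v))).2
  rw [card_interedges_eq, sum_singleton, inter_self, hcard, card_singleton] at h
  simp only [Nat.cast_one, mul_one, one_mul] at h
  have h1 : (d : ℝ) / Fintype.card V * d ≤ d / 2 := by
    rw [div_mul_eq_mul_div, div_le_div_iff₀ hn two_pos]
    nlinarith [(Nat.cast_nonneg d : (0 : ℝ) ≤ d)]
  have h2 : (d : ℝ) = Real.sqrt d ^ 2 := (Real.sq_sqrt (by positivity)).symm
  rcases (Real.sqrt_nonneg (d : ℝ)).eq_or_lt with h0 | h0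
  · rw [← h0]
    have := (abs_nonneg _).trans (hG.2 {v} {v})
    simp at this
    linarith
  · nlinarith

theorem mul_logb_le [DecidableRel G.Adj] [Nonempty V] {d M : ℕ} {lam : ℝ} (hM : 0 < M)
    (hG : IsExpander G d lam) (hd : (d : ℝ) ≤ Fintype.card V / 2)
    (h : (M : ℝ) ≤ 1 / 8192 * ((d : ℝ) ^ (3 / 2 : ℝ) / (lam * Real.logb 2 d))) :
    2 ≤ d ∧ 4096 * (M * Real.logb 2 d) ≤ d := by
  have hM' : (0 : ℝ) < M := by exact_mod_cast hM
  have hs := sqrt_le_two_mul_lam hG hd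
  have hd2 : 2 ≤ d := by
    by_contra! hlt
    -- For `d ≤ 1` the logarithm vanishes, and the bound on `M` reads `M ≤ x / 0 = 0`.
    interval_cases d <;> norm_num at h <;> omega
  refine ⟨hd2, ?_⟩
  have hd' : (2 : ℝ) ≤ d := by exact_mod_cast hd2
  have hlog : 0 < Real.logb 2 d := Real.logb_pos (by norm_num) (by linarith)
  have hsq : 0 < Real.sqrt d := Real.sqrt_pos.2 (by linarith)
  have hlam : 0 < lam := by linarith
  have hpow : (d : ℝ) ^ (3 / 2 : ℝ) = d * Real.sqrt d := by
    rw [Real.sqrt_eq_rpow, ← Real.rpow_one_add' (by linarith) (by norm_num)]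
    norm_num
  rw [hpow, ← mul_div_assoc, le_div_iff₀ (by positivity)] at h
  have h2 : (M : ℝ) * Real.logb 2 d * lam ≤ (1 / 4096 * d) * lam := by
    nlinarith
  have := le_of_mul_le_mul_right h2 hlam
  linarith

theorem numeric_bounds {d M : ℕ} (hM : 0 < M) (hd : 2 ≤ d)
    (h : 4096 * (M * Real.logb 2 d) ≤ d) {z : ℝ}
    (hz : z = Real.exp (-(d : ℝ) / (64 * (M + 1)))) :
    z ≤ 1 / (M + 1) ∧ 2 * ((d + 1) ^ 7 : ℕ) * z ≤ 1 / (16 * M) := by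
  have hM' : (1 : ℝ) ≤ M := by exact_mod_cast hM
  have hd' : (2 : ℝ) ≤ d := by exact_mod_cast hd
  have hd0 : (0 : ℝ) < d := by linarith
  have hlog : 1 ≤ Real.logb 2 d := by
    rw [Real.le_logb_iff_rpow_le (by norm_num) hd0]
    simpa using hd'
  have hdM : 4096 * (M : ℝ) ≤ d := by nlinarith
  have hz0 : 0 ≤ z := hz ▸ (Real.exp_pos _).le
  have hln : Real.log d ≤ Real.logb 2 d := by
    rw [Real.logb, le_div_iff₀ (Real.log_pos (by norm_num))]
    have : Real.log 2 ≤ 1 := by linarith [Real.log_two_lt_d9]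
    nlinarith [Real.log_nonneg (by linarith : (1 : ℝ) ≤ d)]
  have hz32 : z ≤ 1 / (d : ℝ) ^ 32 := by
    have h1 : -(d : ℝ) / (64 * (M + 1)) ≤ -(32 * Real.log d) := by
      rw [neg_div, neg_le_neg_iff, le_div_iff₀ (by positivity)]
      have h0 : 0 ≤ Real.log d := Real.log_nonneg (by linarith)
      nlinarith [mul_le_mul_of_nonneg_left hln (by linarith : (0 : ℝ) ≤ M),
        mul_nonneg h0 (by linarith : (0 : ℝ) ≤ M - 1)]
    calc z ≤ Real.exp (-(32 * Real.log d)) := hz ▸ Real.exp_le_exp.2 h1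
      _ = 1 / (d : ℝ) ^ 32 := by
        rw [Real.exp_neg, one_div, show (32 : ℝ) = ((32 : ℕ) : ℝ) by norm_num, Real.exp_nat_mul,
          Real.exp_log hd0]
  have hinv : 1 / (d : ℝ) ≤ 1 / (4096 * M) := one_div_le_one_div_of_le (by positivity) hdM
  constructor
  · calc z ≤ 1 / (d : ℝ) ^ 32 := hz32
      _ ≤ 1 / (d : ℝ) := one_div_le_one_div_of_le hd0 (le_self_pow₀ (by linarith) (by norm_num))
      _ ≤ 1 / (M + 1) := one_div_le_one_div_of_le (by positivity) (by linarith)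
  · calc 2 * ((d + 1) ^ 7 : ℕ) * z ≤ 2 * (2 * d : ℝ) ^ 7 * (1 / (d : ℝ) ^ 32) := by
          push_cast
          gcongr
          linarith
      _ = 256 * (1 / (d : ℝ) ^ 25) := by field_simp; norm_num
      _ ≤ 256 * (1 / (d : ℝ)) := by
          gcongr
          exact le_self_pow₀ (by linarith) (by norm_num)
      _ ≤ 256 * (1 / (4096 * M)) := by gcongr
      _ = 1 / (16 * M) := by field_simp; norm_num

/-! ### Functions with a prescribed ground state -/

section LipStar

variable {d M : ℕ} {lam : ℝ} {k : ℤ}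

theorem card_outside_le [Nonempty V] (hd : 0 < d) (hlam : lam ≤ d / 5) {f : V → ℤ}
    (hf : f ∈ LipStar G d lam M k) :
    ((univ.filter fun v => f v ∉ Icc k (k + M)).card : ℝ) ≤ 2 / 5 * Fintype.card V := by
  refine hf.2.trans ?_
  have hd' : (0 : ℝ) < d := by exact_mod_cast hd
  refine mul_le_mul_of_nonneg_right ?_ (Nat.cast_nonneg _)
  rw [div_le_iff₀ hd']
  linarith

theorem finite_lipStar (hG : G.Connected) (hd : 0 < d) (hlam : lam ≤ d / 5) :
    (LipStar G d lam M k).Finite := by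
  classical
  have := hG.nonempty
  set D : ℕ := ∑ p : V × V, G.dist p.1 p.2 with hD
  refine (Fintype.piFinset fun _ : V => Icc (k - D * M) (k + M + D * M)).finite_toSet.subset ?_
  intro f hf
  obtain ⟨w, hw⟩ : ∃ w, f w ∈ Icc k (k + M) := by
    by_contra! hcon
    have h1 := card_outside_le hd hlam hf
    rw [filter_true_of_mem fun v _ => hcon v, card_univ] at h1
    have : (0 : ℝ) < Fintype.card V := by exact_mod_cast Fintype.card_pos
    linarith
  rw [mem_coe, Fintype.mem_piFinset]
  intro u
  obtain ⟨p, hp⟩ := hG.exists_walk_length_eq_dist u w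
  have h1 := abs_le.1 (abs_sub_le_length_mul hf.1 p)
  have h2 : p.length ≤ D := by
    rw [hp]
    exact single_le_sum (f := fun p : V × V => G.dist p.1 p.2) (fun _ _ => Nat.zero_le _)
      (mem_univ (u, w))
  have h3 : (p.length : ℤ) * M ≤ D * M := by
    have : (p.length : ℤ) ≤ D := by exact_mod_cast h2
    gcongr
  rw [mem_Icc] at hw ⊢
  omega

theorem const_mem_lipStar (hlam : 0 ≤ lam) : (fun _ => k) ∈ LipStar G d lam M k := by
  refine ⟨fun u v _ => by simp, ?_⟩
  have : (univ.filter fun _ : V => k ∉ Icc k (k + M)) = ∅ :=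
    filter_eq_empty_iff.2 fun _ _ h => h (by simp)
  rw [this, card_empty, Nat.cast_zero]
  positivity

/-- `LipStar` is closed under lowering values, as long as no value is moved below both its old value
and `k`. -/
theorem mem_lipStar_of_le {f h : V → ℤ} (hf : f ∈ LipStar G d lam M k) (hh : h ∈ Lip G M)
    (hle : h ≤ f) {a : ℤ} (ha : k ≤ a) (hge : ∀ u, min (f u) a ≤ h u) :
    h ∈ LipStar G d lam M k := by
  refine ⟨hh, le_trans ?_ hf.2⟩
  norm_cast
  refine card_le_card fun u hu => ?_
  rw [mem_filter] at hu ⊢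
  refine ⟨mem_univ _, fun hfu => hu.2 ?_⟩
  rw [mem_Icc] at hfu ⊢
  have h1 : h u ≤ f u := hle u
  have h2 := hge u
  omega

end LipStar

theorem lt_of_mem_graphBall {V : Type*} {G : SimpleGraph V} {M t : ℕ} {k : ℤ} {f : V → ℤ}
    (hf : f ∈ Lip G M) (ht : 1 ≤ t) {u v : V} (hv : k + t * M + 1 < f v)
    (hu : u ∈ graphBall G v (t - 1)) : k + M + 1 < f u := by
  obtain ⟨p, hp⟩ := G.exists_walk_of_edist_ne_top (ne_top_of_le_ne_top (ENat.natCast_ne_top _) hu)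
  have h1 := abs_le.1 (abs_sub_le_length_mul hf p)
  have h2 : (p.length : ℕ∞) ≤ (t - 1 : ℕ) := hp ▸ hu
  have h3 : p.length + 1 ≤ t := by
    have : p.length ≤ t - 1 := by exact_mod_cast h2
    omega
  have h4 : ((p.length : ℤ) + 1) * M ≤ t * M := by
    have : (p.length : ℤ) + 1 ≤ t := by exact_mod_cast h3
    gcongr
  linarith

theorem uniformOn_real_le {α : Type*} [MeasurableSpace α] [MeasurableSingletonClass α]
    {s t : Set α} (hs : s.Finite) {Ω 𝓕 : Finset α} (hΩ : (Ω : Set α) = s)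
    (h𝓕 : (𝓕 : Set α) = s ∩ t) {r : ℝ} (hr : 0 ≤ r) (h : (𝓕.card : ℝ) ≤ Ω.card * r) :
    (ProbabilityTheory.uniformOn s).real t ≤ r := by
  rw [MeasureTheory.measureReal_def, ProbabilityTheory.uniformOn,
    ProbabilityTheory.cond_apply hs.measurableSet, ← h𝓕, ← hΩ,
    MeasureTheory.Measure.count_apply_finset, MeasureTheory.Measure.count_apply_finset,
    ENNReal.toReal_mul, ENNReal.toReal_inv, ENNReal.toReal_natCast, ENNReal.toReal_natCast]
  rcases (Nat.cast_nonneg Ω.card : (0 : ℝ) ≤ Ω.card).eq_or_lt with h0 | h0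
  · simp [← h0, hr]
  · rw [inv_mul_le_iff₀ h0]
    exact h

end Main

end LipschitzExpander

open LipschitzExpander Finset in
theorem theorem1p3 :
    ∃ c C : ℝ, 0 < c ∧ 0 < C ∧
      ∀ (V : Type*) [Fintype V] (G : SimpleGraph V) [DecidableRel G.Adj]
        (d M : ℕ) (lam : ℝ),
        0 < M →
        G.Connected →
        IsExpander G d lam →
        lam ≤ (d : ℝ) / 5 →
        (d : ℝ) / 5 ≤ c * (Fintype.card V : ℝ) →
        (M : ℝ) ≤ min (c * ((d : ℝ) ^ (3 / 2 : ℝ) / (lam * Real.logb 2 d)))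
          ((Real.logb 2 (Fintype.card V : ℝ)) ^ C) →
        ∀ k : ℤ,
          (LipStar G d lam M k).Finite ∧ (LipStar G d lam M k).Nonempty ∧
          ∀ t : ℕ, 2 ≤ t → ∀ v : V,
            (ProbabilityTheory.uniformOn (LipStar G d lam M k)).real
                {f : V → ℤ | k + (t : ℤ) * (M : ℤ) + 1 < f v} ≤
              (2 : ℝ) ^ (-((graphBall G v (t - 1)).ncard : ℝ) / (5 * (M : ℝ))) := by
  -- With `c = 1 / 8192` one gets `z ≤ d ^ (-32)`, which beats the growth `(d + 1) ^ 7` of the balls.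
  refine ⟨1 / 8192, 1, by norm_num, by norm_num, ?_⟩
  intro V _ G _ d M lam hM hconn hG hlam hdn hMle k
  classical
  have hne := hconn.nonempty
  have hdn' : (d : ℝ) ≤ Fintype.card V / 2 := by
    have : (0 : ℝ) ≤ Fintype.card V := by positivity
    linarith
  obtain ⟨hd2, hlog⟩ := mul_logb_le hM hG hdn' (hMle.trans (min_le_left _ _))
  have hd0 : 0 < d := by omega
  have hlam0 : 0 ≤ lam := by
    have := sqrt_le_two_mul_lam hG hdn'
    linarith [Real.sqrt_nonneg (d : ℝ)]
  have hfin : (LipStar G d lam M k).Finite := finite_lipStar hconn hd0 hlam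
  refine ⟨hfin, ⟨_, const_mem_lipStar hlam0⟩, fun t ht v => ?_⟩
  obtain ⟨hz1, hz2⟩ := numeric_bounds hM hd2 hlog rfl
  have hM' : (1 : ℝ) ≤ M := by exact_mod_cast hM
  set Ω : Finset (V → ℤ) := hfin.toFinset with hΩ
  set 𝓕 : Finset (V → ℤ) := Ω.filter fun f => k + (t : ℤ) * (M : ℤ) + 1 < f v with h𝓕
  set B : Finset V := (graphBall G v (t - 1)).toFinset with hB
  have hmem : ∀ f ∈ 𝓕, f ∈ LipStar G d lam M k ∧ k + (t : ℤ) * (M : ℤ) + 1 < f v := by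
    intro f hf
    simpa [h𝓕, hΩ] using hf
  rw [Set.ncard_eq_toFinset_card']
  refine uniformOn_real_le hfin (Ω := Ω) (𝓕 := 𝓕) (by simp [hΩ]) (by ext; simp [h𝓕, hΩ])
    (by positivity) ?_
  refine (card_elevated_le hG hd0 hlam (a := k + M) (B := B) (Ω := Ω) (𝓕 := 𝓕)
    (fun f hf h hh hle hge => ?_) (fun f hf => (hmem f hf).1.1) (fun f hf u hu => ?_)
    (fun f hf => ?_) rfl hz1 ?_).trans ?_
  · rw [hΩ, Set.Finite.mem_toFinset]
    exact mem_lipStar_of_le (hmem f hf).1 hh hle (by omega) hge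
  · have := lt_of_mem_graphBall (hmem f hf).1.1 (by omega) (hmem f hf).2 (Set.mem_toFinset.1 hu)
    omega
  · refine le_trans ?_ (card_outside_le hd0 hlam (hmem f hf).1)
    norm_cast
    refine card_le_card fun u hu => ?_
    rw [mem_filter] at hu ⊢
    refine ⟨mem_univ _, fun h => ?_⟩
    rw [mem_Icc] at h
    omega
  · rw [← Real.le_log_iff_exp_le (by norm_num)]
    refine hz2.trans ?_
    have : 1 / (16 * (M : ℝ)) ≤ 1 / 16 := one_div_le_one_div_of_le (by norm_num) (by linarith)
    linarith [Real.log_two_gt_d9]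
  · rw [Real.rpow_def_of_pos two_pos]
    gcongr
    have h1 : 1 / (2 * (M : ℝ)) ≤ 1 / (M + 1) :=
      one_div_le_one_div_of_le (by positivity) (by linarith)
    have h2 := Real.log_two_lt_d9
    have hb : (0 : ℝ) ≤ B.card := by positivity
    have h3 : -(1 / ((M : ℝ) + 1)) + 1 / (16 * M) ≤ -(Real.log 2 / (5 * M)) := by
      have : Real.log 2 / (5 * M) + 1 / (16 * (M : ℝ)) ≤ 1 / (2 * M) := by
        rw [div_add_div _ _ (by positivity) (by positivity),
          div_le_div_iff₀ (by positivity) (by positivity)]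
        nlinarith [mul_pos (by linarith : (0 : ℝ) < M) (by linarith : (0 : ℝ) < M)]
      linarith
    calc -(B.card : ℝ) / (M + 1) + 2 * ((d + 1) ^ 7 : ℕ) *
          Real.exp (-(d : ℝ) / (64 * (M + 1))) * B.card
        = (-(1 / ((M : ℝ) + 1)) + 2 * ((d + 1) ^ 7 : ℕ) *
          Real.exp (-(d : ℝ) / (64 * (M + 1)))) * B.card := by ring
      _ ≤ (-(1 / ((M : ℝ) + 1)) + 1 / (16 * M)) * B.card := by gcongr
      _ ≤ -(Real.log 2 / (5 * M)) * B.card := by gcongr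
      _ = _ := by ring
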